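/- Let $p$ be a prime. A graph of pro-$p$ groups $(\mathcal G,\Gamma)$ over a finite connected (nonempty) oriented graph $\Gamma$, loops and multiple edges being allowed, consists of a pro-$p$ group $\mathcal G(v)$ for each vertex $v$, a pro-$p$ group $\mathcal G(e)$ for each edge $e$, and continuous injective homomorphisms $\partial_i:\mathcal G(e)\to\mathcal G(d_i(e))$ ($i=0,1$) for each edge $e$ with initial vertex $d_0(e)$ and terminal vertex $d_1(e)$. It is reduced if for every edge $e$ that is not a loop neither $\partial_0$ nor $\partial_1$ is an isomorphism. Its pro-$p$ fundamental group, with respect to a maximal subtree $D$ of $\Gamma$, is the pro-$p$ group $$\Pi_1(\mathcal G,\Gamma)=\big\langle \mathcal G(v),\,t_e \ \big|\ t_e=1 \text{ for } e\in E(D),\ \ \partial_0(x)=t_e\,\partial_1(x)\,t_e^{-1} \text{ for } x\in\mathcal G(e)\big\rangle\qquad (v\in V(\Gamma),\ e\in E(\Gamma)),$$ that is, the universal pro-$p$ group that receives continuous homomorphisms from the groups $\mathcal G(v)$ and contains elements $t_e$ such that these relations hold. For a profinite group $G$ let $d(G)$ be the minimal number of topological generators of $G$. Let $G=\Pi_1(\mathcal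 G,\Gamma)$ be the pro-$p$ fundamental group of a reduced finite graph of pro-$p$ groups $(\mathcal G,\Gamma)$ whose edge groups are all procyclic, and suppose that $d(G)=d$ with $2\le d<\infty$. Then every vertex group $\mathcal G(v)$ is (topologically) finitely generated, $|V(\Gamma)|\le 2d-1$, and $|E(\Gamma)|\le 3d-2$. -/

import Mathlib

universe u

/-- A profinite group is pro-`p` if each of its open normal subgroups has index a power of `p`. -/
def IsProP (p : ℕ) (G : ProfiniteGrp.{u}) : Prop :=
  ∀ N : Subgroup G, N.Normal → IsOpen (N : Set G) → ∃ k : ℕ, N.index = p ^ k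

/-- `S` generates `G` topologically: the abstract subgroup generated by `S` is dense. -/
def TopologicallyGenerates (G : ProfiniteGrp.{u}) (S : Set G) : Prop :=
  (Subgroup.closure S).topologicalClosure = ⊤

/-- (Topologically) finitely generated profinite groups. -/
def IsTopologicallyFG (G : ProfiniteGrp.{u}) : Prop :=
  ∃ S : Set G, S.Finite ∧ TopologicallyGenerates G S

/-- A profinite group is procyclic if it is topologically generated by one element. -/
def IsProcyclic (G : ProfiniteGrp.{u}) : Prop :=
  ∃ g : G, TopologicallyGenerates G {g}

/-- `d(G)`: the minimal number of topological generators (`⊤` if `G` is not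
finitely generated). -/
noncomputable def minGenerators (G : ProfiniteGrp.{u}) : ℕ∞ :=
  ⨅ (S : Set G) (_ : TopologicallyGenerates G S), S.encard

/-- An (oriented) graph with vertices `V` and edges `E`; loops and multiple edges are allowed. -/
structure OrientedGraph (V E : Type*) where
  /-- initial vertex -/
  d₀ : E → V
  /-- terminal vertex -/
  d₁ : E → V

namespace OrientedGraph

variable {V E : Type*} (Γ : OrientedGraph V E)

/-- `v` and `w` are joined by a path, edges being traversed in either direction, all of whose
edges lie in `S`. -/
def Joined (S : Set E) : V → V → Prop :=
  Relation.EqvGen fun v w => ∃ e ∈ S, Γ.d₀ e = v ∧ Γ.d₁ e = w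

/-- Connected graphs; these are nonempty by convention. -/
def Connected : Prop :=
  Nonempty V ∧ ∀ v w : V, Γ.Joined Set.univ v w

/-- `D` is the edge set of a maximal subtree (i.e. a spanning tree): all vertices of the graph are
joined by paths in `D`, and there is no circuit, i.e. the ends of an edge of `D` are not joined
by a path in `D` that avoids this edge. -/
def IsMaximalSubtree (D : Set E) : Prop :=
  (∀ v w : V, Γ.Joined D v w) ∧ ∀ e ∈ D, ¬ Γ.Joined (D \ {e}) (Γ.d₀ e) (Γ.d₁ e)

end OrientedGraph

/-- A graph of pro-`p` groups over the graph `Γ`. -/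
structure GraphOfProPGroups (p : ℕ) {V E : Type*} (Γ : OrientedGraph V E) where
  vertexGroup : V → ProfiniteGrp.{u}
  edgeGroup : E → ProfiniteGrp.{u}
  isProP_vertexGroup : ∀ v, IsProP p (vertexGroup v)
  isProP_edgeGroup : ∀ e, IsProP p (edgeGroup e)
  /-- the attaching map at the initial vertex -/
  del₀ : ∀ e, edgeGroup e →ₜ* vertexGroup (Γ.d₀ e)
  /-- the attaching map at the terminal vertex -/
  del₁ : ∀ e, edgeGroup e →ₜ* vertexGroup (Γ.d₁ e)
  del₀_injective : ∀ e, Function.Injective (del₀ e)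
  del₁_injective : ∀ e, Function.Injective (del₁ e)

namespace GraphOfProPGroups

variable {p : ℕ} {V E : Type*} {Γ : OrientedGraph V E} (𝒢 : GraphOfProPGroups.{u} p Γ)

/-- For an edge which is not a loop, neither attaching map is an isomorphism. (A continuous
bijective homomorphism between profinite groups is an isomorphism.) -/
def IsReduced : Prop :=
  ∀ e, Γ.d₀ e ≠ Γ.d₁ e →
    ¬ Function.Bijective (𝒢.del₀ e) ∧ ¬ Function.Bijective (𝒢.del₁ e)

/-- Continuous homomorphisms `β` of the vertex groups into `H`, together with elements `s e` of
`H`, trivial for `e` in `D`, such that `β (∂₀ x) = s e * β (∂₁ x) * (s e)⁻¹` for `x` in the edge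
group of `e`. -/
structure IsCompatible (D : Set E) (H : ProfiniteGrp.{u})
    (β : ∀ v, 𝒢.vertexGroup v →ₜ* H) (s : E → H) : Prop where
  eq_one : ∀ e ∈ D, s e = 1
  conj : ∀ (e : E) (x : 𝒢.edgeGroup e),
    β (Γ.d₀ e) (𝒢.del₀ e x) = s e * β (Γ.d₁ e) (𝒢.del₁ e x) * (s e)⁻¹

/-- The pro-`p` group `G` with the maps `ν` and the elements `t` has the universal property of the
pro-`p` fundamental group of `𝒢` with respect to the maximal subtree `D`. -/
structure IsUniversal (D : Set E) (G : ProfiniteGrp.{u})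
    (ν : ∀ v, 𝒢.vertexGroup v →ₜ* G) (t : E → G) : Prop where
  compatible : 𝒢.IsCompatible D G ν t
  existsUnique_hom : ∀ (H : ProfiniteGrp.{u}), IsProP p H →
    ∀ (β : ∀ v, 𝒢.vertexGroup v →ₜ* H) (s : E → H), 𝒢.IsCompatible D H β s →
      ∃! δ : G →ₜ* H, (∀ e, δ (t e) = s e) ∧ ∀ v x, δ (ν v x) = β v x

/-- `G` is (isomorphic to) the pro-`p` fundamental group of the graph of groups `𝒢`. -/
def IsFundamentalGroup (G : ProfiniteGrp.{u}) : Prop :=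
  IsProP p G ∧ ∃ D : Set E, Γ.IsMaximalSubtree D ∧
    ∃ (ν : ∀ v, 𝒢.vertexGroup v →ₜ* G) (t : E → G), 𝒢.IsUniversal D G ν t

end GraphOfProPGroups

/-!
The proof is a dimension count in the first cohomology groups `H¹(G) = Hom(G, 𝔽_p)`, called
`modPDual p G` below. Two facts about them are used: `dim H¹(G) ≤ d(G)`, and, for pro-`p` groups,
every proper closed subgroup is killed by a nonzero element of `H¹`
(`IsProP.exists_modPDual_ne_zero`). By the second one, a pro-`p` group with finite `H¹` is
topologically finitely generated, and if `dim H¹(G) = 1` then `H¹(G)` restricts to zero on all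
proper closed subgroups.

Let `ρ : ∏ H¹(𝒢(v)) → ∏ H¹(𝒢(e))` be the Mayer–Vietoris map. Each `H¹(𝒢(e))` has dimension at most
one, so `rank ρ ≤ |E|`. The universal property gives `dim ker ρ + |E \ D| ≤ d`
(`IsUniversal.finite_ker_and_finrank_le`), where `|D| < |V|` for the tree `D`. Thus all the
`H¹(𝒢(v))` are finite, and with `a v = dim H¹(𝒢(v))`, the sum of the `a v` is at most
`|E| + d - |E \ D| = d + |D| ≤ d + |V| - 1`. If there are several vertices, then no vertex group is
trivial by reducedness, so at most `d - 1` vertices have `a v ≥ 2`. If `a v = 1` and there is no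
loop at `v`, then reducedness puts all of `H¹(𝒢(v))` into `ker ρ`
(`IsReduced.card_le_finrank_ker`); as loops lie outside `D`, there are at most
`dim ker ρ + |E \ D| ≤ d` vertices with `a v = 1`. Hence `|V| ≤ 2d - 1`, and
`|E| ≤ |V| - 1 + |E \ D| ≤ 3d - 2`.
-/

/-! ### The mod-`p` dual of a pro-`p` group -/

/-- The mod-`p` dual `H¹(G, 𝔽_p)` of a topological group: continuous homomorphisms to `ZMod p`,
encoded as a subspace of the space of all functions. -/
def modPDual (p : ℕ) (G : Type*) [Group G] [TopologicalSpace G] :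
    Submodule (ZMod p) (G → ZMod p) where
  carrier := {f | Continuous f ∧ ∀ x y, f (x * y) = f x + f y}
  add_mem' := by
    rintro f g ⟨hf, hf'⟩ ⟨hg, hg'⟩
    refine ⟨hf.add hg, fun x y => ?_⟩
    simp only [Pi.add_apply, hf', hg']
    ring
  zero_mem' := ⟨continuous_const, by simp⟩
  smul_mem' := by
    rintro c f ⟨hf, hf'⟩
    refine ⟨continuous_of_discreteTopology.comp (g := fun a => c * a) hf, fun x y => ?_⟩
    simp [hf', mul_add]

namespace modPDual

section Basic

variable {p : ℕ} {G H : Type*} [Group G] [TopologicalSpace G] [Group H] [TopologicalSpace H]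

lemma continuous (φ : modPDual p G) : Continuous φ.1 := φ.2.1

lemma map_mul (φ : modPDual p G) (x y : G) : φ.1 (x * y) = φ.1 x + φ.1 y := φ.2.2 x y

lemma map_one (φ : modPDual p G) : φ.1 1 = 0 := by
  simpa using modPDual.map_mul φ 1 1

lemma map_inv (φ : modPDual p G) (x : G) : φ.1 x⁻¹ = -φ.1 x :=
  eq_neg_of_add_eq_zero_left (by rw [← modPDual.map_mul φ, inv_mul_cancel, modPDual.map_one φ])

/-- The kernel of an element of the mod-`p` dual. -/
def ker (φ : modPDual p G) : Subgroup G where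
  carrier := {x | φ.1 x = 0}
  mul_mem' := by
    intro a b ha hb
    simp only [Set.mem_ofPred_eq] at ha hb ⊢
    rw [modPDual.map_mul φ, ha, hb, add_zero]
  one_mem' := modPDual.map_one φ
  inv_mem' := by
    intro a ha
    simp only [Set.mem_ofPred_eq] at ha ⊢
    rw [modPDual.map_inv φ, ha, neg_zero]

lemma isClosed_ker (φ : modPDual p G) : IsClosed (modPDual.ker φ : Set G) :=
  (isClosed_discrete {0}).preimage (modPDual.continuous φ)

/-- Pullback along a continuous homomorphism. -/
def comp (φ : modPDual p H) (f : G →ₜ* H) : modPDual p G :=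
  ⟨fun x => φ.1 (f x), (modPDual.continuous φ).comp f.continuous_toFun, fun x y => by
    simp only [_root_.map_mul, modPDual.map_mul φ]⟩

end Basic

lemma eq_zero_of_generates {p : ℕ} {G : ProfiniteGrp.{u}} {S : Set G}
    (hS : TopologicallyGenerates G S) (φ : modPDual p G) (h : ∀ x ∈ S, φ.1 x = 0) : φ = 0 := by
  have h1 : (Subgroup.closure S).topologicalClosure ≤ modPDual.ker φ :=
    Subgroup.topologicalClosure_minimal _ ((Subgroup.closure_le _).2 h) (modPDual.isClosed_ker φ)
  rw [hS] at h1
  ext x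
  exact h1 (Subgroup.mem_top x)

lemma finite_and_finrank_le {p : ℕ} [Fact p.Prime] {G : ProfiniteGrp.{u}} {S : Set G}
    (hfin : S.Finite) (hS : TopologicallyGenerates G S) :
    Module.Finite (ZMod p) (modPDual p G) ∧
      Module.finrank (ZMod p) (modPDual p G) ≤ S.ncard := by
  have := hfin.to_subtype
  have := Fintype.ofFinite S
  let f : modPDual p G →ₗ[ZMod p] (S → ZMod p) :=
    { toFun := fun φ s => φ.1 s
      map_add' := fun _ _ => rfl
      map_smul' := fun _ _ => rfl }
  have hf : Function.Injective f := by
    rw [injective_iff_map_eq_zero]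
    exact fun φ h => eq_zero_of_generates hS φ fun x hx => congrFun h ⟨x, hx⟩
  refine ⟨Module.Finite.of_injective f hf, (LinearMap.finrank_le_finrank_of_injective hf).trans ?_⟩
  rw [Module.finrank_fintype_fun_eq_card, ← Nat.card_eq_fintype_card, Set.ncard, Set.encard,
    Nat.card]
  rfl

end modPDual

/-- A finite `p`-group with a proper subgroup `K` maps nontrivially to `ZMod p` with `K` in the
kernel: maximal subgroups of `p`-groups are normal of index `p`. -/
lemma IsPGroup.exists_hom_zmod {p : ℕ} [Fact p.Prime] {Q : Type*} [Group Q] [Finite Q]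
    (hQ : IsPGroup p Q) {K : Subgroup Q} (hK : K ≠ ⊤) :
    ∃ f : Q →* Multiplicative (ZMod p), K ≤ f.ker ∧ f.ker ≠ ⊤ := by
  obtain ⟨M, hM, hKM⟩ := (eq_top_or_exists_le_coatom K).resolve_left hK
  have := hQ.isNilpotent
  have hMn : M.Normal :=
    Subgroup.NormalizerCondition.normal_of_coatom M Group.normalizerCondition_of_isNilpotent hM
  have hnt : Nontrivial (Q ⧸ M) := by
    rw [QuotientGroup.nontrivial_iff]
    exact hM.1
  have hQM : IsPGroup p (Q ⧸ M) := hQ.to_quotient M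
  have hdvd : p ∣ Nat.card (Q ⧸ M) := by
    obtain ⟨n, hn, h⟩ := hQM.nontrivial_iff_card.1 hnt
    exact h ▸ dvd_pow_self p hn.ne'
  obtain ⟨g, hg⟩ := exists_prime_orderOf_dvd_card' p hdvd
  -- The preimage of `⟨g⟩` lies strictly above the maximal subgroup `M`, hence is everything.
  have htop : (Subgroup.zpowers g).comap (QuotientGroup.mk' M) = ⊤ := by
    refine hM.2 _ (lt_of_le_of_ne (fun x hx => ?_) fun h => ?_)
    · rw [Subgroup.mem_comap, QuotientGroup.mk'_apply, (QuotientGroup.eq_one_iff x).2 hx]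
      exact one_mem _
    · obtain ⟨x, rfl⟩ := QuotientGroup.mk'_surjective M g
      have hx : x ∈ M := by
        rw [h]
        exact Subgroup.mem_zpowers _
      rw [QuotientGroup.mk'_apply, (QuotientGroup.eq_one_iff x).2 hx, orderOf_one] at hg
      exact (Fact.out : p.Prime).one_lt.ne hg
  have hcard : Nat.card (Q ⧸ M) = p := by
    rw [← hg, ← Nat.card_zpowers]
    have : Subgroup.zpowers g = ⊤ := by
      rw [eq_top_iff]
      intro y _
      obtain ⟨x, rfl⟩ := QuotientGroup.mk'_surjective M y
      have hx : x ∈ (Subgroup.zpowers g).comap (QuotientGroup.mk' M) := htop ▸ Subgroup.mem_top x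
      exact hx
    rw [this, Subgroup.card_top]
  have e : Q ⧸ M ≃* Multiplicative (ZMod p) :=
    mulEquivOfPrimeCardEq (p := p) hcard (by simp)
  have hker : (e.toMonoidHom.comp (QuotientGroup.mk' M)).ker = M := by
    ext x
    simp
  exact ⟨_, hker.symm ▸ hKM, hker.symm ▸ hM.1⟩

/-- The Frattini argument for pro-`p` groups: a proper closed subgroup is killed by a nonzero
continuous homomorphism to `ZMod p`. -/
lemma IsProP.exists_modPDual_ne_zero {p : ℕ} [Fact p.Prime] {G : ProfiniteGrp.{u}}
    (hG : IsProP p G) {K : Subgroup G} (hK : IsClosed (K : Set G)) (hKtop : K ≠ ⊤) :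
    ∃ φ : modPDual p G, φ ≠ 0 ∧ ∀ x ∈ K, φ.1 x = 0 := by
  obtain ⟨x, hx⟩ : ∃ x, x ∉ K := by
    by_contra! h
    exact hKtop ((Subgroup.eq_top_iff' K).2 h)
  -- Some open normal subgroup `N` satisfies `x ∉ K N`.
  obtain ⟨N, hN⟩ := ProfiniteGrp.exist_openNormalSubgroup_sub_open_nhds_of_one
    (U := (fun y => x * y) ⁻¹' (K : Set G)ᶜ) (hK.isOpen_compl.preimage (continuous_const_mul x))
    (by simpa using hx)
  have hNopen : IsOpen ((N.toSubgroup : Subgroup G) : Set G) := N.isOpen'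
  obtain ⟨k, hk⟩ := hG N.toSubgroup inferInstance hNopen
  have hdisc : DiscreteTopology (G ⧸ N.toSubgroup) := QuotientGroup.discreteTopology hNopen
  have hfin : Finite (G ⧸ N.toSubgroup) := Subgroup.quotient_finite_of_isOpen _ hNopen
  have hQ : IsPGroup p (G ⧸ N.toSubgroup) := IsPGroup.of_card (n := k) hk
  have hne : K.map (QuotientGroup.mk' N.toSubgroup) ≠ ⊤ := by
    intro h
    have hmem : (x : G ⧸ N.toSubgroup) ∈ K.map (QuotientGroup.mk' N.toSubgroup) :=
      h ▸ Subgroup.mem_top _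
    obtain ⟨y, hy, hxy⟩ := hmem
    have h1 : x⁻¹ * y ∈ N.toSubgroup := QuotientGroup.eq.1 hxy.symm
    have h2 := hN h1
    simp only [Set.mem_preimage, mul_inv_cancel_left] at h2
    exact h2 hy
  obtain ⟨f, hKf, hf⟩ := hQ.exists_hom_zmod hne
  refine ⟨⟨fun y => (f (y : G ⧸ N.toSubgroup)).toAdd,
    (continuous_of_discreteTopology
      (f := fun q : G ⧸ N.toSubgroup => (f q).toAdd)).comp continuous_quotient_mk',
    fun y z => by simp⟩, fun h => hf ?_, fun y hy => ?_⟩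
  · rw [Subgroup.eq_top_iff']
    intro q
    obtain ⟨y, rfl⟩ := QuotientGroup.mk'_surjective _ q
    exact congrFun (congrArg Subtype.val h) y
  · exact hKf (Subgroup.mem_map_of_mem _ hy)

/-- A pro-`p` group with finite mod-`p` dual is finitely generated: take elements at which the
evaluations span the bidual. -/
lemma IsProP.isTopologicallyFG {p : ℕ} [Fact p.Prime] {G : ProfiniteGrp.{u}} (hG : IsProP p G)
    [Module.Finite (ZMod p) (modPDual p G)] : IsTopologicallyFG G := by
  have : Finite (modPDual p G) := Module.finite_of_finite (ZMod p)
  have hx : ∀ φ : modPDual p G, ∃ x : G, φ ≠ 0 → φ.1 x ≠ 0 := by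
    intro φ
    by_cases h : φ = 0
    · exact ⟨1, fun h' => absurd h h'⟩
    · by_contra! h'
      exact h (Subtype.ext (funext fun x => (h' x).2))
  choose x hx using hx
  refine ⟨Set.range x, Set.finite_range x, ?_⟩
  by_contra h
  obtain ⟨φ, hφ, h'⟩ := hG.exists_modPDual_ne_zero (Subgroup.isClosed_topologicalClosure _) h
  exact hx φ hφ (h' _ (Subgroup.le_topologicalClosure _ (Subgroup.subset_closure ⟨φ, rfl⟩)))

lemma IsProP.finrank_modPDual_pos {p : ℕ} [Fact p.Prime] {G : ProfiniteGrp.{u}} (hG : IsProP p G)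
    [Module.Finite (ZMod p) (modPDual p G)] [Nontrivial G] :
    0 < Module.finrank (ZMod p) (modPDual p G) := by
  obtain ⟨φ, hφ, -⟩ := hG.exists_modPDual_ne_zero (K := ⊥) (by simp) bot_ne_top
  exact Module.finrank_pos_iff_exists_ne_zero.2 ⟨φ, hφ⟩

/-- If `H¹` is a line, then it vanishes on every proper closed subgroup. -/
lemma IsProP.modPDual_comp_eq_zero {p : ℕ} [Fact p.Prime] {G A : ProfiniteGrp.{u}}
    (hG : IsProP p G) (h1 : Module.finrank (ZMod p) (modPDual p G) = 1) (f : A →ₜ* G)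
    (hf : ¬ Function.Surjective f) (φ : modPDual p G) (a : A) : φ.1 (f a) = 0 := by
  obtain ⟨ψ, hψ, hψ'⟩ := hG.exists_modPDual_ne_zero (K := f.toMonoidHom.range)
    (by
      rw [MonoidHom.coe_range]
      exact (isCompact_range f.continuous_toFun).isClosed)
    (fun h => hf (MonoidHom.range_eq_top.1 h))
  obtain ⟨c, rfl⟩ := (finrank_eq_one_iff_of_nonzero' ψ hψ).1 h1 φ
  have := hψ' (f a) ⟨a, rfl⟩
  simp [this]

lemma exists_generates_ncard_le {G : ProfiniteGrp.{u}} {d : ℕ} (h : minGenerators G = d) :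
    ∃ S : Set G, S.Finite ∧ TopologicallyGenerates G S ∧ S.ncard ≤ d := by
  have hlt : minGenerators G < (d + 1 : ℕ) := by
    rw [h]
    exact_mod_cast Nat.lt_succ_self d
  simp only [minGenerators, iInf_lt_iff] at hlt
  obtain ⟨S, hS, hlt⟩ := hlt
  have hfin : S.Finite := Set.finite_of_encard_le_coe hlt.le
  refine ⟨S, hfin, hS, ?_⟩
  rw [← hfin.cast_ncard_eq] at hlt
  exact Nat.lt_succ_iff.1 (by exact_mod_cast hlt)

/-! ### Spanning trees -/

namespace OrientedGraph
variable {V E : Type*} {Γ : OrientedGraph V E}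

lemma IsMaximalSubtree.d₀_ne_d₁ {D : Set E} (hD : Γ.IsMaximalSubtree D) {e : E} (he : e ∈ D) :
    Γ.d₀ e ≠ Γ.d₁ e :=
  fun h => hD.2 e he (h ▸ Relation.EqvGen.refl _)

/-- A tree has fewer edges than vertices. The coboundary map from functions on vertices to
functions on `D` is surjective, as the indicator function of the component of `Γ.d₀ e` in
`D \ {e}` goes to minus the indicator function of `e`; and it kills the constants. -/
lemma IsMaximalSubtree.ncard_lt_card [Finite V] [Finite E] [Nonempty V] {D : Set E}
    (hD : Γ.IsMaximalSubtree D) : D.ncard < Nat.card V := by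
  classical
  have := Fintype.ofFinite V
  have := Fintype.ofFinite D
  let c : (V → ℚ) →ₗ[ℚ] (D → ℚ) :=
    { toFun := fun f e => f (Γ.d₁ e) - f (Γ.d₀ e)
      map_add' := fun f g => by
        ext e
        simp only [Pi.add_apply]
        ring
      map_smul' := fun a f => by
        ext e
        simp [mul_sub] }
  have hsurj : LinearMap.range c = ⊤ := by
    rw [eq_top_iff, ← (Pi.basisFun ℚ D).span_eq, Submodule.span_le]
    rintro _ ⟨e, rfl⟩
    refine ⟨fun v => if Γ.Joined (D \ {e.1}) (Γ.d₀ e) v then -1 else 0, ?_⟩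
    ext e'
    simp only [c, LinearMap.coe_mk, AddHom.coe_mk, Pi.basisFun_apply]
    by_cases hee : e' = e
    · subst hee
      have h0 : Γ.Joined (D \ {e'.1}) (Γ.d₀ e') (Γ.d₀ e') := Relation.EqvGen.refl _
      simp [h0, hD.2 e'.1 e'.2]
    · have hj : Γ.Joined (D \ {e.1}) (Γ.d₀ e') (Γ.d₁ e') :=
        Relation.EqvGen.rel _ _ ⟨e', ⟨e'.2, fun h => hee (Subtype.ext h)⟩, rfl, rfl⟩
      have hiff : Γ.Joined (D \ {e.1}) (Γ.d₀ e) (Γ.d₁ e') ↔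
          Γ.Joined (D \ {e.1}) (Γ.d₀ e) (Γ.d₀ e') :=
        ⟨fun h => h.trans _ _ _ (hj.symm _ _), fun h => h.trans _ _ _ hj⟩
      simp [hiff, hee]
  have hker : 0 < Module.finrank ℚ (LinearMap.ker c) := by
    refine Module.finrank_pos_iff_exists_ne_zero.2 ⟨⟨fun _ => 1, ?_⟩, fun h => ?_⟩
    · ext e
      simp [c]
    · simpa using congrFun (congrArg Subtype.val h) (Classical.arbitrary V)
  have hrank := c.finrank_range_add_finrank_ker
  rw [hsurj, finrank_top, Module.finrank_fintype_fun_eq_card, Module.finrank_fintype_fun_eq_card,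
    ← Nat.card_eq_fintype_card, ← Nat.card_eq_fintype_card, Nat.card_coe_set_eq] at hrank
  omega

/-- In a connected graph with several vertices, every vertex is an end of an edge that is not a
loop. -/
lemma Connected.exists_edge_ne (hΓ : Γ.Connected) [Nontrivial V] (v : V) :
    ∃ e, Γ.d₀ e ≠ Γ.d₁ e ∧ (Γ.d₀ e = v ∨ Γ.d₁ e = v) := by
  by_contra! h
  obtain ⟨w, hw⟩ := exists_ne v
  -- If all edges at `v` were loops, then nothing else would be joined to `v`.
  have key : ∀ a b, Γ.Joined Set.univ a b → (a = v ↔ b = v) := by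
    intro a b hab
    induction hab with
    | rel a b hab =>
      obtain ⟨e, -, rfl, rfl⟩ := hab
      by_cases he : Γ.d₀ e = Γ.d₁ e
      · rw [he]
      · simp [h e he]
    | refl a => rfl
    | symm a b _ ih => exact ih.symm
    | trans a b c _ _ ih1 ih2 => exact ih1.trans ih2
  exact hw ((key v w (hΓ.2 v w)).1 rfl)

end OrientedGraph

/-! ### Homomorphisms to the group of order `p` -/

/-- The cyclic group of order `p`, written multiplicatively, as a profinite group in any
universe. -/
abbrev profiniteZMod (p : ℕ) [Fact p.Prime] : ProfiniteGrp.{u} :=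
  ProfiniteGrp.of (ULift.{u} (Multiplicative (ZMod p)))

lemma isProP_profiniteZMod (p : ℕ) [Fact p.Prime] : IsProP p (profiniteZMod.{u} p) := by
  intro N _ _
  have hcard : Nat.card (profiniteZMod.{u} p) = p := by
    change Nat.card (ULift.{u} (Multiplicative (ZMod p))) = p
    simp
  have hdvd : N.index ∣ p ^ 1 := by
    rw [pow_one]
    conv_rhs => rw [← hcard]
    exact N.index_dvd_card
  obtain ⟨k, -, hk⟩ := (Nat.dvd_prime_pow Fact.out).1 hdvd
  exact ⟨k, hk⟩

/-- An element of the mod-`p` dual as a morphism of profinite groups. -/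
def modPDual.toHom {p : ℕ} [Fact p.Prime] {G : ProfiniteGrp.{u}} (φ : modPDual p G) :
    G →ₜ* profiniteZMod.{u} p where
  toFun x := ULift.up (Multiplicative.ofAdd (φ.1 x))
  map_one' := by
    rw [modPDual.map_one φ]
    rfl
  map_mul' x y := by
    rw [modPDual.map_mul φ]
    rfl
  continuous_toFun := continuous_uliftUp.comp (modPDual.continuous φ)

/-- A morphism to the group of order `p` as an element of the mod-`p` dual. -/
def modPDual.ofHom {p : ℕ} [Fact p.Prime] {G : ProfiniteGrp.{u}} (f : G →ₜ* profiniteZMod.{u} p) :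
    modPDual p G :=
  ⟨fun x => (f x).down.toAdd, continuous_uliftDown.comp f.continuous_toFun, fun x y => by
    have h := congrArg (fun a : profiniteZMod.{u} p => (ULift.down a).toAdd) (_root_.map_mul f x y)
    exact h⟩

/-! ### The Mayer–Vietoris map of a graph of groups -/

namespace GraphOfProPGroups

variable {p : ℕ} {V E : Type*} {Γ : OrientedGraph V E} (𝒢 : GraphOfProPGroups.{u} p Γ)

/-- The Mayer–Vietoris map `∏ H¹(𝒢(v)) → ∏ H¹(𝒢(e))`, where elements of `H¹(𝒢(e))` are recorded
by their values at chosen elements `g e` (generators, in the applications). -/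
def edgeDifference (g : ∀ e, 𝒢.edgeGroup e) :
    (∀ v, modPDual p (𝒢.vertexGroup v)) →ₗ[ZMod p] (E → ZMod p) where
  toFun β e := (β (Γ.d₀ e)).1 (𝒢.del₀ e (g e)) - (β (Γ.d₁ e)).1 (𝒢.del₁ e (g e))
  map_add' β β' := by
    ext e
    simp only [Pi.add_apply, Submodule.coe_add]
    ring
  map_smul' c β := by
    ext e
    simp [mul_sub]

variable {𝒢}

lemma eq_of_edgeDifference_eq_zero {g : ∀ e, 𝒢.edgeGroup e}
    (hg : ∀ e, TopologicallyGenerates (𝒢.edgeGroup e) {g e})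
    {β : ∀ v, modPDual p (𝒢.vertexGroup v)} (hβ : 𝒢.edgeDifference g β = 0) (e : E)
    (x : 𝒢.edgeGroup e) :
    (β (Γ.d₀ e)).1 (𝒢.del₀ e x) = (β (Γ.d₁ e)).1 (𝒢.del₁ e x) := by
  have h : modPDual.comp (β (Γ.d₀ e)) (𝒢.del₀ e) - modPDual.comp (β (Γ.d₁ e)) (𝒢.del₁ e) = 0 := by
    refine modPDual.eq_zero_of_generates (hg e) _ ?_
    rintro _ rfl
    exact congrFun hβ e
  exact sub_eq_zero.1 (congrFun (congrArg Subtype.val h) x)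

/-- The universal property of the fundamental group, for homomorphisms to `ZMod p`. -/
lemma IsUniversal.exists_modPDual [Fact p.Prime] {D : Set E} {G : ProfiniteGrp.{u}}
    {ν : ∀ v, 𝒢.vertexGroup v →ₜ* G} {t : E → G} (hU : 𝒢.IsUniversal D G ν t)
    (β : ∀ v, modPDual p (𝒢.vertexGroup v)) (s : E → ZMod p) (hs : ∀ e ∈ D, s e = 0)
    (hβ : ∀ e x, (β (Γ.d₀ e)).1 (𝒢.del₀ e x) = (β (Γ.d₁ e)).1 (𝒢.del₁ e x)) :
    ∃ φ : modPDual p G, (∀ v x, φ.1 (ν v x) = (β v).1 x) ∧ ∀ e, φ.1 (t e) = s e := by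
  obtain ⟨δ, ⟨hδt, hδν⟩, -⟩ := hU.existsUnique_hom (profiniteZMod p) (isProP_profiniteZMod p)
    (fun v => modPDual.toHom (β v)) (fun e => ULift.up (Multiplicative.ofAdd (s e)))
    { eq_one := fun e he => by
        rw [hs e he]
        rfl
      conj := fun e x => by
        have hcomm : ∀ a b : ULift.{u} (Multiplicative (ZMod p)), a * b * a⁻¹ = b := fun a b => by
          rw [mul_comm a b, mul_inv_cancel_right]
        refine Eq.trans ?_ (hcomm _ _).symm
        exact congrArg (fun a => ULift.up (Multiplicative.ofAdd a)) (hβ e x) }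
  refine ⟨modPDual.ofHom δ, fun v x => ?_, fun e => ?_⟩
  · have h := congrArg (fun a : profiniteZMod.{u} p => (ULift.down a).toAdd) (hδν v x)
    exact h
  · have h := congrArg (fun a : profiniteZMod.{u} p => (ULift.down a).toAdd) (hδt e)
    exact h

/-- `H¹` of the fundamental group contains the kernel of the Mayer–Vietoris map, and one more
dimension for each stable letter. -/
lemma IsUniversal.finite_ker_and_finrank_le [Fact p.Prime] [Finite E] {D : Set E}
    {G : ProfiniteGrp.{u}} {ν : ∀ v, 𝒢.vertexGroup v →ₜ* G} {t : E → G}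
    (hU : 𝒢.IsUniversal D G ν t) {g : ∀ e, 𝒢.edgeGroup e}
    (hg : ∀ e, TopologicallyGenerates (𝒢.edgeGroup e) {g e})
    [Module.Finite (ZMod p) (modPDual p G)] :
    Module.Finite (ZMod p) (LinearMap.ker (𝒢.edgeDifference g)) ∧
      Module.finrank (ZMod p) (LinearMap.ker (𝒢.edgeDifference g)) + Dᶜ.ncard ≤
        Module.finrank (ZMod p) (modPDual p G) := by
  classical
  have := Fintype.ofFinite (Dᶜ : Set E)
  let K := LinearMap.ker (𝒢.edgeDifference g)
  let W := ∀ v, modPDual p (𝒢.vertexGroup v)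
  let r : modPDual p G →ₗ[ZMod p] W × ((Dᶜ : Set E) → ZMod p) :=
    { toFun := fun φ => (fun v => modPDual.comp φ (ν v), fun e => φ.1 (t e))
      map_add' := fun _ _ => rfl
      map_smul' := fun _ _ => rfl }
  let F : K × ((Dᶜ : Set E) → ZMod p) →ₗ[ZMod p] W × ((Dᶜ : Set E) → ZMod p) :=
    LinearMap.prodMap K.subtype LinearMap.id
  have hF : ∀ x, F x ∈ LinearMap.range r := by
    rintro ⟨⟨β, hβ⟩, s⟩
    obtain ⟨φ, hφν, hφt⟩ := hU.exists_modPDual β (fun e => if h : e ∈ D then 0 else s ⟨e, h⟩)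
      (fun e he => by simp [he]) (eq_of_edgeDifference_eq_zero hg hβ)
    refine ⟨φ, Prod.ext (funext fun v => Subtype.ext (funext fun x => hφν v x))
      (funext fun e => ?_)⟩
    have he : e.1 ∉ D := e.2
    change φ.1 (t e) = s e
    rw [hφt, dif_neg he]
  have hinj : Function.Injective (F.codRestrict (LinearMap.range r) hF) := by
    intro x y h
    have h' : F x = F y := congrArg Subtype.val h
    have h1 : (F x).1 = (F y).1 := by rw [h']
    have h2 : (F x).2 = (F y).2 := by rw [h']
    exact Prod.ext (Subtype.ext h1) h2
  have hfin : Module.Finite (ZMod p) (K × ((Dᶜ : Set E) → ZMod p)) :=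
    Module.Finite.of_injective _ hinj
  have hK : Module.Finite (ZMod p) K :=
    Module.Finite.of_surjective (LinearMap.fst (ZMod p) K ((Dᶜ : Set E) → ZMod p))
      Prod.fst_surjective
  refine ⟨hK, ?_⟩
  have h1 := (LinearMap.finrank_le_finrank_of_injective hinj).trans r.finrank_range_le
  rwa [Module.finrank_prod, Module.finrank_fintype_fun_eq_card, ← Nat.card_eq_fintype_card,
    Nat.card_coe_set_eq] at h1

/-- A vertex group with one-dimensional `H¹` and without loops contributes a dimension to the
kernel of the Mayer–Vietoris map: in a reduced graph, the incident edge groups are proper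
subgroups, and so are killed by `H¹` of the vertex group. -/
lemma IsReduced.card_le_finrank_ker [Fact p.Prime] [Finite V] (hred : 𝒢.IsReduced)
    (g : ∀ e, 𝒢.edgeGroup e) [Module.Finite (ZMod p) (LinearMap.ker (𝒢.edgeDifference g))]
    (U : Set V) (hU : ∀ v ∈ U, Module.finrank (ZMod p) (modPDual p (𝒢.vertexGroup v)) = 1)
    (hloop : ∀ e, Γ.d₀ e = Γ.d₁ e → Γ.d₀ e ∉ U) :
    U.ncard ≤ Module.finrank (ZMod p) (LinearMap.ker (𝒢.edgeDifference g)) := by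
  classical
  have := Fintype.ofFinite U
  have hφ : ∀ v : U, ∃ φ : modPDual p (𝒢.vertexGroup v), φ ≠ 0 := fun v => by
    obtain ⟨φ, hφ, -⟩ := finrank_eq_one_iff'.1 (hU v v.2)
    exact ⟨φ, hφ⟩
  choose φ hφ using hφ
  let T : (U → ZMod p) →ₗ[ZMod p] (∀ v, modPDual p (𝒢.vertexGroup v)) :=
    { toFun := fun c v => if h : v ∈ U then c ⟨v, h⟩ • φ ⟨v, h⟩ else 0
      map_add' := fun c c' => by
        ext1 v
        by_cases h : v ∈ U <;> simp [h, add_smul]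
      map_smul' := fun a c => by
        ext1 v
        by_cases h : v ∈ U <;> simp [h, mul_smul] }
  have hTv : ∀ c v, v ∉ U → T c v = 0 := fun c v h => dif_neg h
  have hT : ∀ c, T c ∈ LinearMap.ker (𝒢.edgeDifference g) := by
    intro c
    rw [LinearMap.mem_ker]
    ext e
    have h0 : (T c (Γ.d₀ e)).1 (𝒢.del₀ e (g e)) = 0 := by
      by_cases h : Γ.d₀ e ∈ U
      · refine (𝒢.isProP_vertexGroup _).modPDual_comp_eq_zero (hU _ h) _ (fun hs => ?_) _ _
        exact (hred e fun he => hloop e he h).1 ⟨𝒢.del₀_injective e, hs⟩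
      · rw [hTv c _ h]
        rfl
    have h1 : (T c (Γ.d₁ e)).1 (𝒢.del₁ e (g e)) = 0 := by
      by_cases h : Γ.d₁ e ∈ U
      · refine (𝒢.isProP_vertexGroup _).modPDual_comp_eq_zero (hU _ h) _ (fun hs => ?_) _ _
        exact (hred e fun he => hloop e he (he ▸ h)).2 ⟨𝒢.del₁_injective e, hs⟩
      · rw [hTv c _ h]
        rfl
    exact (congrArg₂ (· - ·) h0 h1).trans (sub_zero 0)
  have hinj : Function.Injective (T.codRestrict _ hT) := by
    rw [injective_iff_map_eq_zero]
    intro c hc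
    ext v
    have h1 : T c v = 0 := congrFun (congrArg Subtype.val hc) v
    have h2 : T c v = c v • φ v := dif_pos v.2
    exact (smul_eq_zero.1 (h2.symm.trans h1)).resolve_right (hφ v)
  have h := LinearMap.finrank_le_finrank_of_injective hinj
  rwa [Module.finrank_fintype_fun_eq_card, ← Nat.card_eq_fintype_card,
    Nat.card_coe_set_eq] at h

/-- In a reduced connected graph of groups with several vertices, no vertex group is trivial. -/
lemma IsReduced.nontrivial_vertexGroup [Nontrivial V] (hΓ : Γ.Connected) (hred : 𝒢.IsReduced)
    (v : V) : Nontrivial (𝒢.vertexGroup v) := by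
  by_contra h
  rw [not_nontrivial_iff_subsingleton] at h
  obtain ⟨e, he, rfl | rfl⟩ := hΓ.exists_edge_ne v
  · exact (hred e he).1 ⟨𝒢.del₀_injective e, fun y => ⟨1, Subsingleton.elim _ _⟩⟩
  · exact (hred e he).2 ⟨𝒢.del₁_injective e, fun y => ⟨1, Subsingleton.elim _ _⟩⟩

end GraphOfProPGroups

theorem proposition5p6 (p : ℕ) [Fact p.Prime] {V E : Type*} [Finite V] [Finite E]
    (Γ : OrientedGraph V E) (hΓ : Γ.Connected)
    (𝒢 : GraphOfProPGroups.{u} p Γ) (hred : 𝒢.IsReduced)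
    (hcyc : ∀ e, IsProcyclic (𝒢.edgeGroup e))
    (G : ProfiniteGrp.{u}) (hG : 𝒢.IsFundamentalGroup G)
    (d : ℕ) (hd : 2 ≤ d) (hdG : minGenerators G = d) :
    (∀ v, IsTopologicallyFG (𝒢.vertexGroup v)) ∧
      Nat.card V ≤ 2 * d - 1 ∧ Nat.card E ≤ 3 * d - 2 := by
  classical
  have := Fintype.ofFinite V
  have := Fintype.ofFinite E
  have := hΓ.1
  obtain ⟨-, D, hD, ν, t, hU⟩ := hG
  choose g hg using hcyc
  obtain ⟨S, hSfin, hS, hSd⟩ := exists_generates_ncard_le hdG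
  obtain ⟨hGfin, hGd⟩ := modPDual.finite_and_finrank_le (p := p) hSfin hS
  obtain ⟨hker, hle⟩ := hU.finite_ker_and_finrank_le hg
  -- The kernel and the range of the Mayer–Vietoris map are finite-dimensional, hence so is its
  -- domain.
  have hW : Module.Finite (ZMod p) (∀ v, modPDual p (𝒢.vertexGroup v)) := by
    have := Module.Finite.equiv (𝒢.edgeDifference g).quotKerEquivRange.symm
    exact Module.Finite.of_submodule_quotient (LinearMap.ker (𝒢.edgeDifference g))
  have hfin : ∀ v, Module.Finite (ZMod p) (modPDual p (𝒢.vertexGroup v)) := fun v =>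
    Module.Finite.of_surjective
      (LinearMap.proj (R := ZMod p) (φ := fun v => modPDual p (𝒢.vertexGroup v)) v)
      (Function.surjective_eval v)
  have hrank := (𝒢.edgeDifference g).finrank_range_add_finrank_ker
  have hrange : Module.finrank (ZMod p) (LinearMap.range (𝒢.edgeDifference g)) ≤ Nat.card E := by
    refine (Submodule.finrank_le _).trans ?_
    rw [Module.finrank_fintype_fun_eq_card, Nat.card_eq_fintype_card]
  rw [Module.finrank_pi_fintype] at hrank
  have hDV := hD.ncard_lt_card
  have hDE := Set.ncard_add_ncard_compl D
  refine ⟨fun v => (𝒢.isProP_vertexGroup v).isTopologicallyFG, ?_⟩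
  -- `|E| = |D| + |Dᶜ|` with `|D| < |V|` and `|Dᶜ| ≤ d`, so the bound on `|V|` gives that on `|E|`.
  suffices hV : Nat.card V ≤ 2 * d - 1 from ⟨hV, by omega⟩
  rcases subsingleton_or_nontrivial V with hV | hV
  · have := Finite.card_le_one_iff_subsingleton.2 hV
    omega
  -- If there are several vertices, then no vertex group is trivial, so `a v ≥ 1` below.
  set a : V → ℕ := fun v => Module.finrank (ZMod p) (modPDual p (𝒢.vertexGroup v))
  have hpos : ∀ v, 1 ≤ a v := fun v =>
    have := hred.nontrivial_vertexGroup hΓ v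
    (𝒢.isProP_vertexGroup v).finrank_modPDual_pos
  -- `A` and its complement are the sets of vertices with `a v = 1` and with `a v ≥ 2`.
  set A : Set V := {v | a v = 1} with hA
  -- `L` contains every vertex with a loop, because loops do not lie in the tree `D`.
  set L : Set V := Γ.d₀ '' Dᶜ
  have hLcard : L.ncard ≤ Dᶜ.ncard := Set.ncard_image_le
  have hAL := hred.card_le_finrank_ker g (A \ L) (fun v hv => hv.1)
    fun e he hv => hv.2 ⟨e, fun heD => hD.d₀_ne_d₁ heD he, rfl⟩
  have hAcard : A.ncard ≤ (A \ L).ncard + L.ncard := Set.ncard_le_ncard_sdiff_add_ncard A L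
  have hsum : Nat.card V + Aᶜ.ncard ≤ ∑ v, a v := by
    have h1 : ∑ v : V, (1 + if v ∈ Aᶜ then 1 else 0) ≤ ∑ v, a v := by
      refine Finset.sum_le_sum fun v _ => ?_
      have := hpos v
      by_cases h : a v = 1
      · simp [hA, h]
      · simp only [hA, Set.mem_compl_iff, Set.mem_ofPred_eq, h, not_false_eq_true, if_true]
        omega
    rw [Finset.sum_add_distrib, Finset.sum_boole] at h1
    rw [Set.ncard_eq_toFinset_card', Nat.card_eq_fintype_card, ← Set.filter_mem_univ_eq_toFinset]
    simpa only [Finset.sum_const, Finset.card_univ, smul_eq_mul, mul_one, Nat.cast_id] using h1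
  have hAV := Set.ncard_add_ncard_compl A
  change _ = ∑ v, a v at hrank
  -- Counting with `∑ a v = rank + dim ker`, the rank is at most `|E|`, which gives `|Aᶜ| + 1 ≤ d`;
  -- and `|A| ≤ |A \ L| + |L| ≤ dim ker + |Dᶜ| ≤ d`.
  omega
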